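/- Let $f(z)=\sum_{k\ge 0}a_kz^k$ be a power series with integer coefficients, infinitely many of which are non-zero, and with positive convergence radius $R_f$. Assume that $f$ is a generalized Liouville series, that is, there are integer sequences $(s_n)_{n\ge 1}$ and $(t_n)_{n\ge 0}$ such that $$0\le t_0\le s_1<t_1\le s_2<t_2\le s_3<\cdots,$$ $a_k=0$ for $k<t_0$ and for $s_n<k<t_n$ ($n\ge 1$), $t_n/s_n\to\infty$ as $n\to\infty$, and the quotients $s_{n+1}/t_n$ ($n\ge 1$) are bounded. Fix such sequences and put $P_n(z)=\sum_{k=t_{n-1}}^{s_n}a_kz^k$ for $n\ge 1$. Let $\alpha\in\mathbb{C}$ be an algebraic integer of degree $m$ over $\mathbb{Q}$ with $|\alpha|<R_f$, and assume that $\alpha$ is simple, that is, the only subfields of $\mathbb{Q}(\alpha)$ are $\mathbb{Q}$ and $\mathbb{Q}(\alpha)$. Suppose that $P_n(\alpha)\ne 0$ for infinitely many $n$. Then $f(\alpha)$ is a $U_m$-number. That is, $f(\alpha)$ is transcendental, and $m$ is the smallest positive integer $d$ such that for every real $w>0$ there exist infinitely many algebraic numbers $\beta\in\mathbb{C}$ of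 degree $d$ with $|f(\alpha)-\beta|<H(\beta)^{-w}$, where $H(\beta)$ denotes the maximum of the absolute values of the coefficients of the minimal polynomial of $\beta$ over $\mathbb{Z}$ (the polynomial irreducible in $\mathbb{Z}[T]$ that vanishes at $\beta$, unique up to sign). -/

import Mathlib

open Filter Topology
open scoped IntermediateField

noncomputable section

/-- `IsIntMinpoly P β`: the polynomial `P` is irreducible in `ℤ[T]` and vanishes at `β`. For a given
algebraic `β` such a `P` exists and is unique up to sign. -/
def IsIntMinpoly (P : Polynomial ℤ) (β : ℂ) : Prop :=
  Irreducible P ∧ Polynomial.aeval β P = 0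

/-- The algebraic numbers `β` of degree `d` with `|γ - β| < H(β) ^ (-w)`, where `H(β)` is the maximal
absolute value of the coefficients of the minimal polynomial of `β` over `ℤ`. -/
def closeAlgebraicNumbers (γ : ℂ) (d : ℕ) (w : ℝ) : Set ℂ :=
  {β : ℂ | IsAlgebraic ℚ β ∧ (minpoly ℚ β).natDegree = d ∧
    ∃ P : Polynomial ℤ, IsIntMinpoly P β ∧ ‖γ - β‖ < P.supNorm ^ (-w)}

/-- `γ` is a `U_m`-number: it is transcendental, and `m` is the smallest positive integer such that
for every `w > 0` there are infinitely many algebraic `β` of degree `m` with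
`|γ - β| < H(β) ^ (-w)`. -/
def IsUmNumber (m : ℕ) (γ : ℂ) : Prop :=
  Transcendental ℚ γ ∧
    IsLeast {d : ℕ | 0 < d ∧ ∀ w : ℝ, 0 < w → (closeAlgebraicNumbers γ d w).Infinite} m

/-- An algebraic number `α` is simple if the only subfields of `ℚ(α)` are `ℚ` and `ℚ(α)`. -/
def IsSimpleAlgebraic (α : ℂ) : Prop :=
  IsAlgebraic ℚ α ∧ ∀ K : IntermediateField ℚ ℂ, K ≤ ℚ⟮α⟯ → K = ⊥ ∨ K = ℚ⟮α⟯

namespace PowerSeries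

/-- The radius of convergence of `∑ a_k z ^ k` over `ℂ`. -/
def complexRadius (f : PowerSeries ℤ) : ENNReal :=
  (FormalMultilinearSeries.ofScalars ℂ (fun k : ℕ => ((coeff k f : ℤ) : ℂ))).radius

/-- The value `f(z) = ∑ a_k z ^ k` (used inside the disc of convergence only). -/
def complexValue (f : PowerSeries ℤ) (z : ℂ) : ℂ :=
  ∑' k : ℕ, ((coeff k f : ℤ) : ℂ) * z ^ k

/-- `f` is a generalized Liouville series with respect to the sequences `(s_n)_{n ≥ 1}` and
`(t_n)_{n ≥ 0}`; the entry `s 0` plays no role. -/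
structure IsGeneralizedLiouvilleWith (f : PowerSeries ℤ) (s t : ℕ → ℕ) : Prop where
  radius_pos : 0 < f.complexRadius
  infinite_support : {k : ℕ | coeff k f ≠ 0}.Infinite
  t_le_s : ∀ n, t n ≤ s (n + 1)
  s_lt_t : ∀ n, 1 ≤ n → s n < t n
  coeff_eq_zero_initial : ∀ k, k < t 0 → coeff k f = 0
  coeff_eq_zero_gap : ∀ n, 1 ≤ n → ∀ k, s n < k → k < t n → coeff k f = 0
  lacunary : Tendsto (fun n => (t n : ℝ) / (s n : ℝ)) atTop atTop
  bounded_ratio : ∃ A : ℝ, ∀ n, 1 ≤ n → (s (n + 1) : ℝ) / (t n : ℝ) ≤ A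

/-- The polynomial `P_n(z) = ∑_{k = t_{n-1}}^{s_n} a_k z ^ k`, for `n ≥ 1`. -/
def lacunaryBlock (f : PowerSeries ℤ) (s t : ℕ → ℕ) (n : ℕ) : Polynomial ℤ :=
  ∑ k ∈ Finset.Icc (t (n - 1)) (s n), Polynomial.monomial k (coeff k f)

end PowerSeries

end

/-!
Write `γ = f(α)` and let `x n` be the partial sum of the series at `α` up to the gap between `s n`
and `t n`. It is an algebraic integer of `ℚ(α)`. By geometric convergence `|γ - x n| ≤ C q ^ (-t n)`
with some `q > 1`, while all conjugates of `x n`, and hence its height, are at most exponential in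
`s n`. Since `t n / s n → ∞`, the `x n` are Liouville-type approximations of `γ`.

The tool is Liouville's inequality (`one_le_norm_sub_mul_of_aeval_ne_zero`): the norm of `P(x n)`,
for an integer polynomial `P` that does not vanish at `x n`, is a non-zero integer. So a root `β` of
`P` satisfies `|x n - β| ≥ H(P) ^ (-k) M ^ (-s n)`, where `k` is the degree of the number field and
`M` depends only on bounds for `deg P` and `|β|`.

* If `γ` were a root of `P`, then `P(x n) = 0` for all large `n`; the `x n`, running through finitely
  many values and converging, would be constant from some point on, against the non-vanishing of
  infinitely many blocks (`transcendental_complexValue`).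
* If `x n` were rational infinitely often, it would be an integer infinitely often, and so would be
  the limit `γ`. Hence `ℚ(x n) = ℚ(α)` for large `n`, because `α` is simple
  (`eventually_natDegree_minpoly_eq`), and the `x n` show that `γ` is approximable to every order in
  degree `m` (`infinite_closeAlgebraicNumbers`).
* A number `β` of degree `d < m` differs from `x n` for large `n`. Taking the first `n` for which
  `q ^ t n` exceeds a fixed power of `H(β)` puts `|γ - x n|` below the lower bound for `|x n - β|`,
  and the boundedness of `s (n + 1) / t n` gives `|γ - β| ≥ H(β) ^ (-w)` with `w`
  independent of `β` (`exists_one_le_norm_sub_mul_pow`, `exists_finite_closeAlgebraicNumbers`).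
-/

/-! ### Bounds for integer polynomials at complex points -/

theorem norm_aeval_le_supNorm (P : Polynomial ℤ) {d : ℕ} (hd : P.natDegree ≤ d) {z : ℂ} {R : ℝ}
    (hR : 1 ≤ R) (hz : ‖z‖ ≤ R) :
    ‖Polynomial.aeval z P‖ ≤ (d + 1) * P.supNorm * R ^ d := by
  rw [Polynomial.aeval_eq_sum_range' (Nat.lt_succ_of_le hd)]
  refine (norm_sum_le_of_le (f := fun k => P.coeff k • z ^ k) _
    (n := fun _ => P.supNorm * R ^ d) fun k hk => ?_).trans ?_
  · rw [zsmul_eq_mul, norm_mul, norm_pow]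
    have h1 : ‖((P.coeff k : ℤ) : ℂ)‖ ≤ P.supNorm := by
      simpa [Int.norm_eq_abs] using P.le_supNorm k
    have h2 : ‖z‖ ^ k ≤ R ^ d := (pow_le_pow_left₀ (norm_nonneg _) hz k).trans
      (pow_le_pow_right₀ hR (Nat.lt_succ_iff.mp (Finset.mem_range.mp hk)))
    exact mul_le_mul h1 h2 (by positivity) P.supNorm_nonneg
  · simp [mul_assoc]

theorem norm_pow_sub_pow_le_mul {z w : ℂ} {R : ℝ} (hR : 1 ≤ R) (hz : ‖z‖ ≤ R) (hw : ‖w‖ ≤ R)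
    (k : ℕ) : ‖z ^ k - w ^ k‖ ≤ ‖z - w‖ * (k * R ^ k) := by
  induction k with
  | zero => simp
  | succ k ih =>
    have hw' : ‖w‖ ^ k ≤ R ^ (k + 1) := (pow_le_pow_left₀ (norm_nonneg _) hw k).trans
      (pow_le_pow_right₀ hR k.le_succ)
    calc ‖z ^ (k + 1) - w ^ (k + 1)‖ = ‖z * (z ^ k - w ^ k) + (z - w) * w ^ k‖ := by ring_nf
      _ ≤ ‖z‖ * ‖z ^ k - w ^ k‖ + ‖z - w‖ * ‖w‖ ^ k := by
        simpa only [norm_mul, norm_pow] using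
          norm_add_le (z * (z ^ k - w ^ k)) ((z - w) * w ^ k)
      _ ≤ R * (‖z - w‖ * (k * R ^ k)) + ‖z - w‖ * R ^ (k + 1) := by gcongr
      _ = ‖z - w‖ * ((k + 1 : ℕ) * R ^ (k + 1)) := by push_cast; ring

theorem norm_aeval_sub_aeval_le (P : Polynomial ℤ) {d : ℕ} (hd : P.natDegree ≤ d) {z w : ℂ}
    {R : ℝ} (hR : 1 ≤ R) (hz : ‖z‖ ≤ R) (hw : ‖w‖ ≤ R) :
    ‖Polynomial.aeval z P - Polynomial.aeval w P‖ ≤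
      ‖z - w‖ * (d * ((d + 1) * P.supNorm * R ^ d)) := by
  rw [Polynomial.aeval_eq_sum_range' (Nat.lt_succ_of_le hd),
    Polynomial.aeval_eq_sum_range' (Nat.lt_succ_of_le hd), ← Finset.sum_sub_distrib]
  refine (norm_sum_le_of_le (f := fun k => P.coeff k • z ^ k - P.coeff k • w ^ k) _
    (n := fun _ => P.supNorm * (‖z - w‖ * (d * R ^ d))) fun k hk => ?_).trans ?_
  · have hk' : k ≤ d := Nat.lt_succ_iff.mp (Finset.mem_range.mp hk)
    rw [← smul_sub, zsmul_eq_mul, norm_mul]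
    have h1 : ‖((P.coeff k : ℤ) : ℂ)‖ ≤ P.supNorm := by
      simpa [Int.norm_eq_abs] using P.le_supNorm k
    have h2 : ‖z ^ k - w ^ k‖ ≤ ‖z - w‖ * (d * R ^ d) :=
      (norm_pow_sub_pow_le_mul hR hz hw k).trans (by gcongr)
    exact mul_le_mul h1 h2 (norm_nonneg _) P.supNorm_nonneg
  · simp only [Finset.sum_const, Finset.card_range, nsmul_eq_mul]
    push_cast
    exact le_of_eq (by ring)

theorem one_le_supNorm {P : Polynomial ℤ} (hP : P ≠ 0) : 1 ≤ P.supNorm := by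
  have h := P.le_supNorm P.natDegree
  refine le_trans ?_ h
  rw [Int.norm_eq_abs]
  exact_mod_cast Int.one_le_abs (Polynomial.leadingCoeff_ne_zero.mpr hP)

/-! ### Liouville's inequality -/

/-- An algebraic integer lives in an abstract number field with an embedding into `ℂ`. -/
theorem exists_numberField_of_isIntegral {α : ℂ} (hint : IsIntegral ℤ α) :
    ∃ (K : Type) (_ : Field K) (_ : NumberField K) (φ : K →ₐ[ℚ] ℂ) (a : K),
      IsIntegral ℤ a ∧ φ a = α := by
  have : FiniteDimensional ℚ ℚ⟮α⟯ := IntermediateField.adjoin.finiteDimensional hint.tower_top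
  exact ⟨ℚ⟮α⟯, inferInstance, ⟨⟩, (algebraMap ℚ⟮α⟯ ℂ).toRatAlgHom,
    IntermediateField.AdjoinSimple.gen ℚ α,
    (isIntegral_algHom_iff (ℚ⟮α⟯.val.restrictScalars ℤ) ℚ⟮α⟯.val.injective).mp hint, rfl⟩

theorem isIntegral_aeval_int {R : Type*} [CommRing R] {a : R} (ha : IsIntegral ℤ a)
    (P : Polynomial ℤ) : IsIntegral ℤ (Polynomial.aeval a P) :=
  IsIntegral.of_mem_of_fg _ ha.fg_adjoin_singleton _ (Polynomial.aeval_mem_adjoin_singleton ℤ a)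

theorem map_aeval_int {K : Type*} [Field K] [CharZero K] (σ : K →ₐ[ℚ] ℂ) (a : K)
    (P : Polynomial ℤ) : σ (Polynomial.aeval a P) = Polynomial.aeval (σ a) P :=
  (Polynomial.aeval_algHom_apply (σ.restrictScalars ℤ) a P).symm

section NumberField

variable {K : Type*} [Field K] [NumberField K]

/-- The absolute norm of a non-zero algebraic integer is at least `1`, so one conjugate cannot be
small unless another one is large. -/
theorem one_le_norm_mul_pow_of_isIntegral (φ : K →ₐ[ℚ] ℂ) {y : K} (hy : IsIntegral ℤ y)
    (hy0 : y ≠ 0) {B : ℝ} (hB : ∀ σ : K →ₐ[ℚ] ℂ, ‖σ y‖ ≤ B) :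
    1 ≤ ‖φ y‖ * B ^ (Module.finrank ℚ K - 1) := by
  classical
  obtain ⟨N, hN⟩ := IsIntegrallyClosed.isIntegral_iff.mp (Algebra.isIntegral_norm ℚ hy)
  have hN0 : N ≠ 0 := by
    rintro rfl
    exact Algebra.norm_ne_zero_iff.mpr hy0 (by rw [← hN]; simp)
  have h := Algebra.norm_eq_prod_embeddings ℚ ℂ y
  rw [← hN] at h
  have h1 : (1 : ℝ) ≤ ‖∏ σ : K →ₐ[ℚ] ℂ, σ y‖ := by
    rw [← h]
    simpa using (by exact_mod_cast Int.one_le_abs hN0 : (1 : ℝ) ≤ |(N : ℝ)|)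
  refine h1.trans ?_
  rw [← Finset.mul_prod_erase _ _ (Finset.mem_univ φ), norm_mul, norm_prod]
  refine mul_le_mul_of_nonneg_left ?_ (norm_nonneg _)
  refine (Finset.prod_le_prod (fun _ _ => norm_nonneg _) fun σ _ => hB σ).trans (le_of_eq ?_)
  rw [Finset.prod_const, Finset.card_erase_of_mem (Finset.mem_univ _), Finset.card_univ,
    AlgHom.card]

/-- Liouville's inequality: an algebraic integer `x` of a number field, all of whose conjugates are
at most `R`, keeps away from every root `β` of an integer polynomial not vanishing at `x`. -/
theorem one_le_norm_sub_mul_of_aeval_ne_zero (φ : K →ₐ[ℚ] ℂ) {x : K} (hx : IsIntegral ℤ x)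
    {P : Polynomial ℤ} {d : ℕ} (hd : P.natDegree ≤ d) {β : ℂ} (hβ : Polynomial.aeval β P = 0)
    {R : ℝ} (hR : 1 ≤ R) (hβR : ‖β‖ ≤ R) (hxR : ∀ σ : K →ₐ[ℚ] ℂ, ‖σ x‖ ≤ R)
    (hPx : Polynomial.aeval (φ x) P ≠ 0) :
    1 ≤ ‖φ x - β‖ * (P.supNorm ^ Module.finrank ℚ K *
      ((d + 1) ^ (Module.finrank ℚ K + 1) * (R ^ d) ^ Module.finrank ℚ K)) := by
  have hy := isIntegral_aeval_int hx P
  have hy0 : Polynomial.aeval x P ≠ 0 := fun h => hPx (by rw [← map_aeval_int, h, map_zero])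
  have h := one_le_norm_mul_pow_of_isIntegral φ hy hy0 (B := (d + 1) * P.supNorm * R ^ d)
    fun σ => by rw [map_aeval_int]; exact norm_aeval_le_supNorm P hd hR (hxR σ)
  have h2 := norm_aeval_sub_aeval_le P hd hR (hxR φ) hβR
  rw [hβ, sub_zero] at h2
  rw [map_aeval_int] at h
  have hH := P.supNorm_nonneg
  have hn : 0 < Module.finrank ℚ K := Module.finrank_pos
  generalize Module.finrank ℚ K = n at *
  obtain ⟨n, rfl⟩ : ∃ k, n = k + 1 := ⟨n - 1, by omega⟩
  rw [Nat.add_sub_cancel] at h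
  calc 1 ≤ _ := h
    _ ≤ ‖φ x - β‖ * ((d + 1) * ((d + 1) * P.supNorm * R ^ d)) *
          ((d + 1) * P.supNorm * R ^ d) ^ n := by
        gcongr
        refine h2.trans ?_
        gcongr
        linarith
    _ = _ := by simp only [mul_pow]; ring

/-- The height of an algebraic integer is bounded in terms of its largest conjugate. -/
theorem supNorm_minpoly_int_le (φ : K →ₐ[ℚ] ℂ) {x : K} (hx : IsIntegral ℤ x) {R : ℝ} (hR : 1 ≤ R)
    (hxR : ∀ σ : K →ₐ[ℚ] ℂ, ‖σ x‖ ≤ R) :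
    (minpoly ℤ (φ x)).supNorm ≤ R ^ Module.finrank ℚ K * 2 ^ Module.finrank ℚ K := by
  obtain ⟨i, hi⟩ := (minpoly ℤ (φ x)).exists_eq_supNorm
  have h := NumberField.Embeddings.coeff_bdd_of_norm_le (A := ℂ) (B := R) (x := x)
    (fun σ => by simpa using hxR σ.toRatAlgHom) i
  have h1 : minpoly ℚ x = (minpoly ℤ (φ x)).map (algebraMap ℤ ℚ) := by
    have hφx : IsIntegral ℤ (φ x) := hx.map (φ.restrictScalars ℤ)
    rw [← minpoly.isIntegrallyClosed_eq_field_fractions' ℚ hφx, minpoly.algHom_eq φ φ.injective]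
  rw [h1, Polynomial.coeff_map, max_eq_left hR] at h
  rw [hi]
  refine le_trans (le_of_eq ?_) (h.trans ?_)
  · simp [Int.norm_eq_abs]
  · gcongr
    exact_mod_cast Nat.choose_le_two_pow _ _

end NumberField

/-! ### Approximation along rapidly growing sequences -/

theorem eventually_mul_le_of_tendsto_div {s t : ℕ → ℕ}
    (hst : Tendsto (fun n => (t n : ℝ) / (s n : ℝ)) atTop atTop) (k : ℕ) :
    ∀ᶠ n in atTop, k * s n ≤ t n := by
  filter_upwards [hst.eventually_ge_atTop (k : ℝ)] with n hn
  rcases Nat.eq_zero_or_pos (s n) with h | h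
  · simp [h]
  · exact_mod_cast (le_div_iff₀ (by exact_mod_cast h)).mp hn

theorem eventually_mul_pow_lt_pow {s t : ℕ → ℕ}
    (hst : Tendsto (fun n => (t n : ℝ) / (s n : ℝ)) atTop atTop) (hs : Tendsto s atTop atTop)
    {q : ℝ} (hq : 1 < q) (C : ℝ) (k : ℕ) : ∀ᶠ n in atTop, C * q ^ (k * s n) < q ^ t n := by
  have hC := ((tendsto_pow_atTop_atTop_of_one_lt hq).comp hs).eventually_gt_atTop C
  filter_upwards [eventually_mul_le_of_tendsto_div hst (k + 1), hC] with n h1 h2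
  have hq0 : 0 < q := by linarith
  calc C * q ^ (k * s n) < q ^ s n * q ^ (k * s n) :=
        mul_lt_mul_of_pos_right h2 (by positivity)
    _ = q ^ ((k + 1) * s n) := by rw [← pow_add]; ring_nf
    _ ≤ q ^ t n := pow_le_pow_right₀ hq.le h1

/-- If `γ` has approximations `x n` with error `q ^ (-t n)` which repel `β` to the distance
`H ^ (-m) * q ^ (-L * s n)`, where `s n` is much smaller than `t n` but `s (n + 1) = O(t n)`, then
`γ` itself repels `β` to a distance `H ^ (-w)` with `w` independent of `β` and `H`. The right `n` is
the first one with `H ^ (2 * (m + 1)) ≤ q ^ t n`: this makes the error smaller than the repelling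
distance, while minimality bounds `q ^ t (n - 1)`, and so `q ^ s n`, by a power of `H`. -/
theorem exists_one_le_norm_sub_mul_pow {x : ℕ → ℂ} {γ : ℂ} {s t : ℕ → ℕ} {q C : ℝ} (hq : 1 < q)
    (hx : ∀ n, ‖γ - x n‖ * q ^ t n ≤ C) {A : ℕ} (hA : ∀ n, 1 ≤ n → s (n + 1) ≤ A * t n) {L : ℕ}
    (hL : ∀ᶠ n in atTop, 2 * L * s n ≤ t n) (ht : Tendsto t atTop atTop) (m n₀ : ℕ) :
    ∃ (w : ℕ) (H₀ : ℝ), ∀ H ≥ H₀, ∀ β : ℂ,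
      (∀ n ≥ n₀, 1 ≤ ‖x n - β‖ * (H ^ m * q ^ (L * s n))) → 1 ≤ ‖γ - β‖ * H ^ w := by
  obtain ⟨n₁, hn₁⟩ := eventually_atTop.mp hL
  set n₂ := max (max n₀ n₁) 1
  have hq0 : 0 < q := by linarith
  refine ⟨m + 1 + 2 * (m + 1) * (A * L), max (max 2 (2 * C)) (q ^ t n₂ + 1), fun H hH β hβ => ?_⟩
  simp only [ge_iff_le, max_le_iff] at hH
  obtain ⟨⟨hH2, hHC⟩, hHq⟩ := hH
  have hex : ∃ n, n₂ ≤ n ∧ H ^ (2 * (m + 1)) ≤ q ^ t n :=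
    ((eventually_ge_atTop n₂).and (((tendsto_pow_atTop_atTop_of_one_lt hq).comp
      ht).eventually_ge_atTop (H ^ (2 * (m + 1))))).exists
  classical
  obtain ⟨hn, hnq⟩ := Nat.find_spec hex
  have hmin := fun k => Nat.find_min hex (m := k)
  generalize Nat.find hex = n at hn hnq hmin
  have hne : n ≠ n₂ := by
    rintro rfl
    have : H ^ 1 ≤ H ^ (2 * (m + 1)) := pow_le_pow_right₀ (by linarith) (by omega)
    rw [pow_one] at this
    linarith
  obtain ⟨k, rfl⟩ : ∃ k, n = k + 1 := ⟨n - 1, by omega⟩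
  have hk : n₂ ≤ k := by omega
  have hkq : q ^ t k ≤ H ^ (2 * (m + 1)) := by
    by_contra hcon
    exact hmin k (by omega) ⟨hk, (not_le.mp hcon).le⟩
  have hk1 : 1 ≤ k := (le_max_right _ _).trans hk
  have hn0 : n₀ ≤ k + 1 := ((le_max_left _ _).trans (le_max_left _ _)).trans hn
  have hn1 : n₁ ≤ k + 1 := ((le_max_right _ _).trans (le_max_left _ _)).trans hn
  set D := H ^ m * q ^ (L * s (k + 1)) with hD
  have hD0 : 0 < D := by positivity
  -- `q ^ t` dominates `(H * D) ^ 2`, hence `H * D`, and `H` absorbs the constant `2 * C`.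
  have hDq : H * D ≤ q ^ t (k + 1) := by
    refine (pow_le_pow_iff_left₀ (by positivity) (by positivity) two_ne_zero).mp ?_
    calc (H * D) ^ 2 = H ^ (2 * (m + 1)) * q ^ (2 * L * s (k + 1)) := by rw [hD]; ring
      _ ≤ q ^ t (k + 1) * q ^ t (k + 1) :=
        mul_le_mul hnq (pow_le_pow_right₀ hq.le (hn₁ _ hn1)) (by positivity) (by positivity)
      _ = (q ^ t (k + 1)) ^ 2 := by ring
  have hfar : ‖x (k + 1) - γ‖ * D ≤ 1 / 2 := by
    have h1 := hx (k + 1)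
    rw [norm_sub_rev] at h1
    have h2 : ‖x (k + 1) - γ‖ * (H * D) ≤ C :=
      (mul_le_mul_of_nonneg_left hDq (norm_nonneg _)).trans h1
    have h3 : (‖x (k + 1) - γ‖ * D) * H ≤ 1 / 2 * H := by nlinarith
    exact le_of_mul_le_mul_right h3 (by linarith)
  have hDle : D ≤ H ^ m * H ^ (2 * (m + 1) * (A * L)) := by
    refine mul_le_mul_of_nonneg_left ?_ (by positivity)
    calc q ^ (L * s (k + 1)) ≤ q ^ (t k * (A * L)) := by
          refine pow_le_pow_right₀ hq.le ?_
          calc L * s (k + 1) ≤ L * (A * t k) := Nat.mul_le_mul_left _ (hA k hk1)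
            _ = t k * (A * L) := by ring
      _ ≤ _ := by
          rw [pow_mul q, pow_mul H _ (A * L)]
          exact pow_le_pow_left₀ (by positivity) hkq _
  have htri : ‖x (k + 1) - β‖ ≤ ‖x (k + 1) - γ‖ + ‖γ - β‖ := norm_sub_le_norm_sub_add_norm_sub _ _ _
  have hnear : 1 / 2 ≤ ‖γ - β‖ * D := by
    have h1 := hβ (k + 1) hn0
    have h2 := mul_le_mul_of_nonneg_right htri hD0.le
    linarith
  calc (1 : ℝ) ≤ 2 * (‖γ - β‖ * D) := by linarith
    _ ≤ H * (‖γ - β‖ * (H ^ m * H ^ (2 * (m + 1) * (A * L)))) := by gcongr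
    _ = _ := by ring

/-! ### Values of power series with integer coefficients -/

namespace PowerSeries

theorem aeval_trunc {R : Type*} [CommRing R] (f : PowerSeries ℤ) (N : ℕ) (z : R) :
    Polynomial.aeval z (trunc N f) = ∑ k ∈ Finset.range N, ((coeff k f : ℤ) : R) * z ^ k := by
  rw [Polynomial.aeval_def, eval₂_trunc_eq_sum_range]
  rfl

theorem exists_norm_coeff_mul_pow_le (f : PowerSeries ℤ) {r : NNReal}
    (hr : (r : ENNReal) < f.complexRadius) :
    ∃ C > 0, ∀ k, ‖((coeff k f : ℤ) : ℂ)‖ * (r : ℝ) ^ k ≤ C := by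
  obtain ⟨C, hC, h⟩ := FormalMultilinearSeries.norm_mul_pow_le_of_lt_radius _ hr
  exact ⟨C, hC, fun k => by simpa using h k⟩

/-- Inside the disc of convergence the partial sums converge geometrically. -/
theorem exists_norm_complexValue_sub_mul_pow_le (f : PowerSeries ℤ) {α : ℂ}
    (hα : ENNReal.ofReal ‖α‖ < f.complexRadius) :
    ∃ (q C : ℝ), 1 < q ∧
      ∀ N, ‖f.complexValue α - Polynomial.aeval α (trunc N f)‖ * q ^ N ≤ C := by
  obtain ⟨r, hr1, hr2⟩ := ENNReal.lt_iff_exists_nnreal_btwn.mp hα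
  have hr1' : ‖α‖ < r := by
    rwa [← ENNReal.ofReal_coe_nnreal, ENNReal.ofReal_lt_ofReal_iff_of_nonneg (norm_nonneg _)] at hr1
  have hr0 : (0 : ℝ) < r := (norm_nonneg _).trans_lt hr1'
  obtain ⟨C, hC, h⟩ := f.exists_norm_coeff_mul_pow_le hr2
  set θ : ℝ := max (‖α‖ / r) (1 / 2) with hθ
  have hθ1 : θ < 1 := max_lt ((div_lt_one hr0).mpr hr1') (by norm_num)
  have hθ0 : 0 < θ := lt_of_lt_of_le (by norm_num) (le_max_right _ _)
  have hbound : ∀ k, ‖((coeff k f : ℤ) : ℂ) * α ^ k‖ ≤ C * θ ^ k := fun k => by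
    have hαθ : ‖α‖ ≤ r * θ := by
      rw [mul_comm, ← div_le_iff₀ hr0]
      exact le_max_left _ _
    calc ‖((coeff k f : ℤ) : ℂ) * α ^ k‖ = ‖((coeff k f : ℤ) : ℂ)‖ * ‖α‖ ^ k := by
          rw [norm_mul, norm_pow]
      _ ≤ ‖((coeff k f : ℤ) : ℂ)‖ * (r * θ) ^ k := by gcongr
      _ = (‖((coeff k f : ℤ) : ℂ)‖ * (r : ℝ) ^ k) * θ ^ k := by rw [mul_pow]; ring
      _ ≤ C * θ ^ k := mul_le_mul_of_nonneg_right (h k) (by positivity)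
  have hsum : Summable fun k => ((coeff k f : ℤ) : ℂ) * α ^ k :=
    Summable.of_norm_bounded ((summable_geometric_of_lt_one hθ0.le hθ1).mul_left C) hbound
  refine ⟨θ⁻¹, C / (1 - θ), (one_lt_inv₀ hθ0).mpr hθ1, fun N => ?_⟩
  have h1 := norm_sub_le_of_geometric_bound_of_hasSum hθ1 hbound hsum.hasSum N
  rw [norm_sub_rev] at h1
  rw [aeval_trunc, inv_pow, ← div_eq_mul_inv, div_le_iff₀ (by positivity)]
  exact h1.trans (le_of_eq (by ring))

namespace IsGeneralizedLiouvilleWith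

variable {f : PowerSeries ℤ} {s t : ℕ → ℕ}

theorem strictMono_t (hf : f.IsGeneralizedLiouvilleWith s t) : StrictMono t :=
  strictMono_nat_of_lt_succ fun n => (hf.t_le_s n).trans_lt (hf.s_lt_t (n + 1) (by omega))

theorem tendsto_t (hf : f.IsGeneralizedLiouvilleWith s t) : Tendsto t atTop atTop :=
  hf.strictMono_t.tendsto_atTop

theorem tendsto_s (hf : f.IsGeneralizedLiouvilleWith s t) : Tendsto s atTop atTop :=
  (tendsto_add_atTop_iff_nat 1).mp (tendsto_atTop_mono hf.t_le_s hf.tendsto_t)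

theorem exists_s_succ_le_mul_t (hf : f.IsGeneralizedLiouvilleWith s t) :
    ∃ A : ℕ, ∀ n, 1 ≤ n → s (n + 1) ≤ A * t n := by
  obtain ⟨A, hA⟩ := hf.bounded_ratio
  obtain ⟨B, hB⟩ := exists_nat_ge A
  refine ⟨B, fun n hn => ?_⟩
  have h0 : (0 : ℝ) < t n := by exact_mod_cast (Nat.zero_le _).trans_lt (hf.s_lt_t n hn)
  exact_mod_cast (div_le_iff₀ h0).mp ((hA n hn).trans hB)

/-- The gap between `s n` and `t n` makes the partial sum up to `t n` a polynomial of degree at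
most `s n`. -/
theorem aeval_trunc_eq (hf : f.IsGeneralizedLiouvilleWith s t) {R : Type*} [CommRing R] (z : R)
    {n : ℕ} (hn : 1 ≤ n) : Polynomial.aeval z (trunc (t n) f) =
      ∑ k ∈ Finset.range (s n + 1), ((coeff k f : ℤ) : R) * z ^ k := by
  rw [aeval_trunc]
  refine (Finset.sum_subset (Finset.range_mono (hf.s_lt_t n hn)) fun k hk hk' => ?_).symm
  rw [Finset.mem_range] at hk hk'
  rw [hf.coeff_eq_zero_gap n hn k (by omega) hk, Int.cast_zero, zero_mul]

theorem aeval_trunc_succ_sub (hf : f.IsGeneralizedLiouvilleWith s t) {R : Type*} [CommRing R]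
    (z : R) (n : ℕ) :
    Polynomial.aeval z (trunc (t (n + 1)) f) - Polynomial.aeval z (trunc (t n) f) =
      Polynomial.aeval z (f.lacunaryBlock s t (n + 1)) := by
  rw [hf.aeval_trunc_eq z (by omega), aeval_trunc, lacunaryBlock, map_sum, Nat.add_sub_cancel,
    ← Finset.sum_Ico_eq_sub _ ((hf.t_le_s n).trans (Nat.le_succ _))]
  refine Finset.sum_congr (by ext; simp) fun k _ => ?_
  rw [Polynomial.aeval_monomial]
  simp

/-- On a bounded set the `n`-th lacunary partial sum is at most exponential in `s n`. -/
theorem exists_norm_aeval_trunc_le_pow (hf : f.IsGeneralizedLiouvilleWith s t) (B : ℝ) :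
    ∃ G : ℝ, 1 ≤ G ∧ ∀ n, 1 ≤ n → 1 ≤ s n → ∀ z : ℂ, ‖z‖ ≤ B →
      ‖Polynomial.aeval z (trunc (t n) f)‖ ≤ G ^ s n := by
  obtain ⟨r, hr1, hr2⟩ := ENNReal.lt_iff_exists_nnreal_btwn.mp hf.radius_pos
  have hr0 : (0 : ℝ) < r := by simpa using hr1
  obtain ⟨C, hC, h⟩ := f.exists_norm_coeff_mul_pow_le hr2
  set E := max C 1
  set D := max (B / r) 1
  have hE : 1 ≤ E := le_max_right _ _
  have hD : 1 ≤ D := le_max_right _ _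
  refine ⟨2 * (E * D), by nlinarith, fun n hn hs z hz => ?_⟩
  rw [hf.aeval_trunc_eq z hn]
  refine (norm_sum_le_of_le (f := fun k => ((coeff k f : ℤ) : ℂ) * z ^ k) _
    (n := fun _ => E * D ^ s n) fun k hk => ?_).trans ?_
  · have hzD : ‖z‖ ≤ r * D := by
      rw [mul_comm, ← div_le_iff₀ hr0]
      exact (div_le_div_of_nonneg_right hz hr0.le).trans (le_max_left _ _)
    calc ‖((coeff k f : ℤ) : ℂ) * z ^ k‖ = ‖((coeff k f : ℤ) : ℂ)‖ * ‖z‖ ^ k := by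
          rw [norm_mul, norm_pow]
      _ ≤ ‖((coeff k f : ℤ) : ℂ)‖ * (r * D) ^ k := by gcongr
      _ = (‖((coeff k f : ℤ) : ℂ)‖ * (r : ℝ) ^ k) * D ^ k := by rw [mul_pow]; ring
      _ ≤ E * D ^ s n := mul_le_mul ((h k).trans (le_max_left _ _))
          (pow_le_pow_right₀ hD (Nat.lt_succ_iff.mp (Finset.mem_range.mp hk)))
          (by positivity) (by positivity)
  · have h2 : ((s n + 1 : ℕ) : ℝ) ≤ 2 ^ s n := by exact_mod_cast Nat.lt_two_pow_self
    have h3 : E ≤ E ^ s n := le_self_pow₀ hE (by omega)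
    rw [Finset.sum_const, Finset.card_range, nsmul_eq_mul, mul_pow, mul_pow]
    gcongr

end IsGeneralizedLiouvilleWith

end PowerSeries

/-! ### Conjugates and heights of the lacunary partial sums -/

namespace PowerSeries.IsGeneralizedLiouvilleWith

variable {f : PowerSeries ℤ} {s t : ℕ → ℕ}

section NumberField

variable {K : Type*} [Field K] [NumberField K]

theorem exists_norm_conjugate_le_pow (hf : f.IsGeneralizedLiouvilleWith s t) (a : K) :
    ∃ G : ℝ, 1 ≤ G ∧ ∀ n, 1 ≤ n → 1 ≤ s n → ∀ σ : K →ₐ[ℚ] ℂ,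
      ‖σ (Polynomial.aeval a (trunc (t n) f))‖ ≤ G ^ s n := by
  obtain ⟨B, hB⟩ := (Set.finite_range fun σ : K →ₐ[ℚ] ℂ => ‖σ a‖).bddAbove
  obtain ⟨G, hG, h⟩ := hf.exists_norm_aeval_trunc_le_pow B
  refine ⟨G, hG, fun n hn hs σ => ?_⟩
  rw [map_aeval_int]
  exact h n hn hs _ (hB (Set.mem_range_self σ))

theorem exists_supNorm_minpoly_le_pow (hf : f.IsGeneralizedLiouvilleWith s t) (φ : K →ₐ[ℚ] ℂ)
    {a : K} (ha : IsIntegral ℤ a) : ∃ M : ℝ, 1 ≤ M ∧ ∀ n, 1 ≤ n → 1 ≤ s n →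
      (minpoly ℤ (Polynomial.aeval (φ a) (trunc (t n) f))).supNorm ≤ M ^ s n := by
  obtain ⟨G, hG, h⟩ := hf.exists_norm_conjugate_le_pow a
  refine ⟨G ^ Module.finrank ℚ K * 2 ^ Module.finrank ℚ K,
    one_le_mul_of_one_le_of_one_le (one_le_pow₀ hG) (one_le_pow₀ one_le_two), fun n hn hs => ?_⟩
  have h1 := supNorm_minpoly_int_le φ (isIntegral_aeval_int ha (trunc (t n) f))
    (one_le_pow₀ hG) (h n hn hs)
  rw [map_aeval_int] at h1
  refine h1.trans ?_
  have h2 : (2 : ℝ) ^ Module.finrank ℚ K ≤ (2 ^ Module.finrank ℚ K) ^ s n :=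
    le_self_pow₀ (one_le_pow₀ one_le_two) (by omega)
  rw [mul_pow, ← pow_mul, ← pow_mul, mul_comm (s n), ← pow_mul] at *
  gcongr

/-- Liouville's inequality for the lacunary partial sums: the base `M` depends only on bounds for the
degree and the absolute value of the number that is repelled. -/
theorem exists_one_le_norm_sub_mul (hf : f.IsGeneralizedLiouvilleWith s t) (φ : K →ₐ[ℚ] ℂ)
    {a : K} (ha : IsIntegral ℤ a) (d : ℕ) (ρ : ℝ) : ∃ M : ℝ, 1 ≤ M ∧ ∀ n, 1 ≤ n → 1 ≤ s n →
      ∀ (P : Polynomial ℤ) (β : ℂ), P.natDegree ≤ d → Polynomial.aeval β P = 0 → ‖β‖ ≤ ρ →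
        Polynomial.aeval (Polynomial.aeval (φ a) (trunc (t n) f)) P ≠ 0 →
        1 ≤ ‖Polynomial.aeval (φ a) (trunc (t n) f) - β‖ *
          (P.supNorm ^ Module.finrank ℚ K * M ^ s n) := by
  obtain ⟨G, hG, h⟩ := hf.exists_norm_conjugate_le_pow a
  set R := max G ρ
  have hR : 1 ≤ R := hG.trans (le_max_left _ _)
  set n₀ := Module.finrank ℚ K
  have hd1 : (1 : ℝ) ≤ (d + 1) ^ (n₀ + 1) := one_le_pow₀ (by linarith [Nat.cast_nonneg (α := ℝ) d])
  refine ⟨(d + 1) ^ (n₀ + 1) * (R ^ d) ^ n₀, ?_, fun n hn hs P β hPd hβ hβρ hne => ?_⟩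
  · exact one_le_mul_of_one_le_of_one_le hd1 (one_le_pow₀ (one_le_pow₀ hR))
  rw [← map_aeval_int] at hne ⊢
  refine (one_le_norm_sub_mul_of_aeval_ne_zero φ (isIntegral_aeval_int ha _) hPd hβ
    (one_le_pow₀ (n := s n) hR) ((hβρ.trans (le_max_right _ _)).trans (le_self_pow₀ hR (by omega)))
    (fun σ => (h n hn hs σ).trans (pow_le_pow_left₀ (by linarith) (le_max_left _ _) _))
    hne).trans ?_
  have hH := P.supNorm_nonneg
  have h2 : ((d : ℝ) + 1) ^ (n₀ + 1) ≤ ((d + 1) ^ (n₀ + 1)) ^ s n :=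
    le_self_pow₀ hd1 (by omega)
  rw [mul_pow]
  refine mul_le_mul_of_nonneg_left (mul_le_mul_of_nonneg_left (mul_le_mul h2 (le_of_eq ?_)
    (by positivity) (by positivity)) (by positivity)) (norm_nonneg _)
  ring

end NumberField

/-! ### Transcendence -/

theorem eventually_index (hf : f.IsGeneralizedLiouvilleWith s t) :
    ∀ᶠ n in atTop, 1 ≤ n ∧ 1 ≤ s n :=
  (eventually_ge_atTop 1).and (hf.tendsto_s.eventually_ge_atTop 1)

theorem tendsto_aeval_trunc (hf : f.IsGeneralizedLiouvilleWith s t) {α : ℂ}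
    (hα : ENNReal.ofReal ‖α‖ < f.complexRadius) :
    Tendsto (fun n => Polynomial.aeval α (trunc (t n) f)) atTop (𝓝 (f.complexValue α)) := by
  obtain ⟨q, C, hq, h⟩ := f.exists_norm_complexValue_sub_mul_pow_le hα
  rw [tendsto_iff_norm_sub_tendsto_zero]
  refine squeeze_zero (fun _ => norm_nonneg _) (fun n => ?_)
    (((tendsto_pow_atTop_atTop_of_one_lt hq).comp hf.tendsto_t).const_div_atTop C)
  rw [norm_sub_rev]
  exact (le_div_iff₀ (pow_pos (by linarith) _)).mpr (h (t n))

/-- If `f(α)` were a root of an integer polynomial, Liouville's inequality would force all late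
partial sums to be roots of it as well, and they could not change any more. -/
theorem transcendental_complexValue (hf : f.IsGeneralizedLiouvilleWith s t) {α : ℂ}
    (hint : IsIntegral ℤ α) (hα : ENNReal.ofReal ‖α‖ < f.complexRadius)
    (hne : {n : ℕ | 1 ≤ n ∧ Polynomial.aeval α (f.lacunaryBlock s t n) ≠ 0}.Infinite) :
    Transcendental ℚ (f.complexValue α) := by
  intro halg
  obtain ⟨P, hP0, hP⟩ := (IsFractionRing.isAlgebraic_iff ℤ ℚ ℂ).mpr halg
  obtain ⟨K, _, _, φ, a, ha, rfl⟩ := exists_numberField_of_isIntegral hint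
  obtain ⟨q, C, hq, htail⟩ := f.exists_norm_complexValue_sub_mul_pow_le hα
  obtain ⟨M, hM1, hM⟩ := hf.exists_one_le_norm_sub_mul φ ha P.natDegree ‖f.complexValue (φ a)‖
  obtain ⟨L, hL⟩ := pow_unbounded_of_one_lt M hq
  set x := fun n => Polynomial.aeval (φ a) (trunc (t n) f) with hx
  have hlim := hf.tendsto_aeval_trunc hα
  have hroot : ∀ᶠ n in atTop, Polynomial.aeval (x n) P = 0 := by
    filter_upwards [hf.eventually_index, eventually_mul_pow_lt_pow hf.lacunary hf.tendsto_s hq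
      (C * P.supNorm ^ Module.finrank ℚ K) L] with n hn hlt
    by_contra hcon
    have h1 := hM n hn.1 hn.2 P _ le_rfl hP le_rfl hcon
    have h2 := htail (t n)
    rw [norm_sub_rev] at h2
    set e := ‖Polynomial.aeval (φ a) (trunc (t n) f) - f.complexValue (φ a)‖ with he
    have hH := P.supNorm_nonneg
    have hML : M ^ s n ≤ q ^ (L * s n) := by
      rw [pow_mul]
      exact pow_le_pow_left₀ (by linarith) hL.le _
    have hq0 : 0 < q := by linarith
    have h3 : q ^ t n ≤ C * P.supNorm ^ Module.finrank ℚ K * q ^ (L * s n) :=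
      calc q ^ t n = 1 * q ^ t n := (one_mul _).symm
        _ ≤ e * (P.supNorm ^ Module.finrank ℚ K * M ^ s n) * q ^ t n := by gcongr
        _ = (e * q ^ t n) * (P.supNorm ^ Module.finrank ℚ K * M ^ s n) := by ring
        _ ≤ C * (P.supNorm ^ Module.finrank ℚ K * q ^ (L * s n)) := by
          gcongr
          exact (by positivity : 0 ≤ e * q ^ t n).trans h2
        _ = _ := by ring
    exact absurd h3 (not_le.mpr hlt)
  -- The roots other than the limit form a closed set, which `x n` avoids in the end.
  have hfin : ((P.aroots ℂ).toFinset : Set ℂ).Finite := Finset.finite_toSet _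
  have hconst : ∀ᶠ n in atTop, x n = f.complexValue (φ a) := by
    have hev := hlim.eventually
      ((hfin.subset (Set.sdiff_subset (t := {f.complexValue (φ a)}))).isClosed.isOpen_compl.mem_nhds
        (by simp))
    filter_upwards [hroot, hev] with n h1 h2
    by_contra h3
    refine h2 ⟨?_, h3⟩
    rw [Finset.mem_coe, Multiset.mem_toFinset]
    exact Polynomial.mem_aroots.mpr ⟨hP0, h1⟩
  obtain ⟨N, hN⟩ := eventually_atTop.mp hconst
  refine hne ((Set.finite_le_nat N).subset fun n hn => ?_)
  by_contra hcon
  have hlt : N < n := not_le.mp hcon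
  obtain ⟨k, rfl⟩ : ∃ k, n = k + 1 := ⟨n - 1, by omega⟩
  refine hn.2 ?_
  rw [← hf.aeval_trunc_succ_sub]
  have h1 := hN k (by omega)
  have h2 := hN (k + 1) (by omega)
  simp only [hx] at h1 h2
  rw [h1, h2, sub_self]

/-! ### The degree of the partial sums -/

/-- Late partial sums are irrational, since a rational one is an integer and a limit of integers is
an integer; as `ℚ(α)` has no proper subfields but `ℚ`, they generate it. -/
theorem eventually_natDegree_minpoly_eq (hf : f.IsGeneralizedLiouvilleWith s t) {α : ℂ}
    (hint : IsIntegral ℤ α) (hsimple : IsSimpleAlgebraic α)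
    (hα : ENNReal.ofReal ‖α‖ < f.complexRadius)
    (htr : Transcendental ℚ (f.complexValue α)) :
    ∀ᶠ n in atTop, (minpoly ℚ (Polynomial.aeval α (trunc (t n) f))).natDegree =
      (minpoly ℚ α).natDegree := by
  have hZ : ∀ᶠ n in atTop,
      Polynomial.aeval α (trunc (t n) f) ∉ Set.range ((↑) : ℤ → ℂ) := by
    by_contra hcon
    have hfreq : ∃ᶠ n in atTop,
        Polynomial.aeval α (trunc (t n) f) ∈ Set.range ((↑) : ℤ → ℂ) := by
      simpa [Filter.Frequently] using hcon
    obtain ⟨N, hN⟩ := Complex.isClosed_range_intCast.mem_of_frequently_of_tendsto hfreq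
      (hf.tendsto_aeval_trunc hα)
    exact htr (hN ▸ isAlgebraic_intCast N)
  filter_upwards [hZ] with n hn
  set y := Polynomial.aeval α (trunc (t n) f) with hy
  have hyint : IsIntegral ℤ y := isIntegral_aeval_int hint _
  have hyK : y ∈ ℚ⟮α⟯ := by
    rw [hy, aeval_trunc]
    exact sum_mem fun k _ => mul_mem (intCast_mem _ _)
      (pow_mem (IntermediateField.mem_adjoin_simple_self ℚ α) k)
  rcases hsimple.2 ℚ⟮y⟯ (IntermediateField.adjoin_simple_le_iff.mpr hyK) with h | h
  · rw [IntermediateField.adjoin_simple_eq_bot_iff, IntermediateField.mem_bot] at h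
    obtain ⟨c, hc⟩ := h
    rw [← hc, isIntegral_algebraMap_iff (algebraMap ℚ ℂ).injective] at hyint
    obtain ⟨N, rfl⟩ := IsIntegrallyClosed.isIntegral_iff.mp hyint
    exact absurd ⟨N, by rw [← hc]; simp⟩ hn
  · rw [← IntermediateField.adjoin.finrank hyint.tower_top, h,
      IntermediateField.adjoin.finrank hint.tower_top]

end PowerSeries.IsGeneralizedLiouvilleWith

/-! ### Minimal polynomials over the integers -/

theorem IsIntMinpoly.natDegree_eq {P : Polynomial ℤ} {β : ℂ} (h : IsIntMinpoly P β) :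
    P.natDegree = (minpoly ℚ β).natDegree := by
  obtain ⟨hirr, hβ⟩ := h
  have hdeg : P.natDegree ≠ 0 := by
    intro h0
    rw [Polynomial.eq_C_of_natDegree_eq_zero h0, Polynomial.aeval_C] at hβ
    refine hirr.ne_zero ?_
    rw [Polynomial.eq_C_of_natDegree_eq_zero h0, (by simpa using hβ : P.coeff 0 = 0),
      Polynomial.C_0]
  have hirr' := (Polynomial.IsPrimitive.Int.irreducible_iff_irreducible_map_cast
    (hirr.isPrimitive hdeg)).mp hirr
  have h1 := minpoly.eq_of_irreducible (x := β) hirr'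
    ((Polynomial.aeval_map_algebraMap ℚ β P).trans hβ)
  rw [← h1, Polynomial.natDegree_mul_C (inv_ne_zero (Polynomial.leadingCoeff_ne_zero.mpr
    hirr'.ne_zero)), Polynomial.natDegree_map_eq_of_injective (RingHom.injective_int _)]

theorem isIntMinpoly_minpoly {β : ℂ} (h : IsIntegral ℤ β) : IsIntMinpoly (minpoly ℤ β) β :=
  ⟨minpoly.irreducible h, minpoly.aeval ℤ β⟩

theorem finite_setOf_supNorm_le (d : ℕ) (B : ℝ) :
    {β : ℂ | ∃ P : Polynomial ℤ, IsIntMinpoly P β ∧ P.natDegree ≤ d ∧ P.supNorm ≤ B}.Finite := by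
  classical
  refine (Polynomial.bUnion_roots_finite (algebraMap ℤ ℂ) d
    (Set.finite_Icc (-⌊B⌋) ⌊B⌋)).subset ?_
  rintro β ⟨P, hP, hd, hB⟩
  simp only [Set.mem_iUnion]
  refine ⟨P, ⟨hd, fun i => ?_⟩, ?_⟩
  · rw [Set.mem_Icc, ← abs_le, Int.le_floor]
    simpa [Int.norm_eq_abs] using (P.le_supNorm i).trans hB
  · rw [Finset.mem_coe, Multiset.mem_toFinset]
    exact Polynomial.mem_aroots.mpr ⟨hP.1.ne_zero, hP.2⟩

/-! ### Approximability in each degree -/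

namespace PowerSeries.IsGeneralizedLiouvilleWith

variable {f : PowerSeries ℤ} {s t : ℕ → ℕ} {α : ℂ} {m : ℕ}

/-- The lacunary partial sums approximate `f(α)` to any order in terms of their height. -/
theorem infinite_closeAlgebraicNumbers (hf : f.IsGeneralizedLiouvilleWith s t)
    (hint : IsIntegral ℤ α) (hα : ENNReal.ofReal ‖α‖ < f.complexRadius)
    (htr : Transcendental ℚ (f.complexValue α))
    (hdeg : ∀ᶠ n in atTop, (minpoly ℚ (Polynomial.aeval α (trunc (t n) f))).natDegree = m)
    (w : ℝ) : (closeAlgebraicNumbers (f.complexValue α) m w).Infinite := by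
  obtain ⟨K, _, _, φ, a, ha, rfl⟩ := exists_numberField_of_isIntegral hint
  obtain ⟨M, hM1, hM⟩ := hf.exists_supNorm_minpoly_le_pow φ ha
  obtain ⟨q, C, hq, htail⟩ := f.exists_norm_complexValue_sub_mul_pow_le hα
  obtain ⟨L, hL⟩ := pow_unbounded_of_one_lt M hq
  obtain ⟨W, hW⟩ := exists_nat_ge w
  have hmem : ∀ᶠ n in atTop, Polynomial.aeval (φ a) (trunc (t n) f) ∈
      closeAlgebraicNumbers (f.complexValue (φ a)) m w := by
    filter_upwards [hdeg, hf.eventually_index, eventually_mul_pow_lt_pow hf.lacunary hf.tendsto_s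
      hq C (L * W)] with n hn hidx hlt
    have hyint : IsIntegral ℤ (Polynomial.aeval (φ a) (trunc (t n) f)) :=
      isIntegral_aeval_int hint _
    refine ⟨hyint.tower_top.isAlgebraic, hn, _, isIntMinpoly_minpoly hyint, ?_⟩
    have hH1 := one_le_supNorm (minpoly.ne_zero hyint)
    have hHM := hM n hidx.1 hidx.2
    set H := (minpoly ℤ (Polynomial.aeval (φ a) (trunc (t n) f))).supNorm
    have hq0 : 0 < q := by linarith
    have hM0 : M ^ s n ≤ q ^ (L * s n) := by
      rw [pow_mul]
      exact pow_le_pow_left₀ (by linarith) hL.le _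
    have hHq : H ^ W ≤ q ^ (L * W * s n) :=
      calc H ^ W ≤ (q ^ (L * s n)) ^ W := pow_le_pow_left₀ (by linarith) (hHM.trans hM0) _
        _ = q ^ (L * W * s n) := by rw [← pow_mul]; ring_nf
    have hHw : (H ^ W)⁻¹ ≤ H ^ (-w) := by
      rw [← Real.rpow_natCast, ← Real.rpow_neg (by linarith)]
      exact Real.rpow_le_rpow_of_exponent_le hH1 (by linarith)
    refine lt_of_lt_of_le ?_ hHw
    have h1 : ‖f.complexValue (φ a) - Polynomial.aeval (φ a) (trunc (t n) f)‖ * H ^ W * q ^ t n <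
        1 * q ^ t n :=
      calc _ = (‖f.complexValue (φ a) - Polynomial.aeval (φ a) (trunc (t n) f)‖ * q ^ t n) *
            H ^ W := by ring
        _ ≤ C * q ^ (L * W * s n) := by
          refine mul_le_mul (htail _) hHq (by positivity) ?_
          exact (by positivity : (0 : ℝ) ≤ _ * q ^ t n).trans (htail (t n))
        _ < 1 * q ^ t n := by rwa [one_mul]
    rw [← one_div, lt_div_iff₀ (by positivity)]
    exact lt_of_mul_lt_mul_right h1 (by positivity)
  intro hfin
  -- A finite set is closed, so it would contain the limit of the partial sums.
  exact htr (hfin.isClosed.mem_of_tendsto (hf.tendsto_aeval_trunc hα) hmem).1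

/-- In degrees below that of the partial sums, `f(α)` is approximable to a bounded order only. -/
theorem exists_finite_closeAlgebraicNumbers (hf : f.IsGeneralizedLiouvilleWith s t)
    (hint : IsIntegral ℤ α) (hα : ENNReal.ofReal ‖α‖ < f.complexRadius)
    (hdeg : ∀ᶠ n in atTop, (minpoly ℚ (Polynomial.aeval α (trunc (t n) f))).natDegree = m)
    {d : ℕ} (hd : d < m) :
    ∃ w : ℝ, 0 < w ∧ (closeAlgebraicNumbers (f.complexValue α) d w).Finite := by
  obtain ⟨K, _, _, φ, a, ha, rfl⟩ := exists_numberField_of_isIntegral hint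
  set γ := f.complexValue (φ a)
  obtain ⟨M, hM1, hM⟩ := hf.exists_one_le_norm_sub_mul φ ha d (‖γ‖ + 1)
  obtain ⟨q, C, hq, htail⟩ := f.exists_norm_complexValue_sub_mul_pow_le hα
  obtain ⟨L, hL⟩ := pow_unbounded_of_one_lt M hq
  obtain ⟨A, hA⟩ := hf.exists_s_succ_le_mul_t
  obtain ⟨n₀, hn₀⟩ := eventually_atTop.mp (hdeg.and hf.eventually_index)
  obtain ⟨w, H₀, hw⟩ := exists_one_le_norm_sub_mul_pow hq (fun n => htail (t n)) hA
    (eventually_mul_le_of_tendsto_div hf.lacunary (2 * L)) hf.tendsto_t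
    (Module.finrank ℚ K) n₀
  refine ⟨w + 1, by positivity, (finite_setOf_supNorm_le d H₀).subset ?_⟩
  rintro β ⟨-, hβd, P, hP, hlt⟩
  have hPd : P.natDegree = d := hP.natDegree_eq.trans hβd
  refine ⟨P, hP, hPd.le, ?_⟩
  by_contra hH
  have hH1 := one_le_supNorm hP.1.ne_zero
  have hlt1 : ‖γ - β‖ < 1 := hlt.trans_le (Real.rpow_le_one_of_one_le_of_nonpos hH1 (by
    have : (0 : ℝ) ≤ w := Nat.cast_nonneg w
    linarith))
  have hβ : ‖β‖ ≤ ‖γ‖ + 1 := by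
    have := norm_sub_norm_le β γ
    rw [norm_sub_rev] at this
    linarith
  have hfar : 1 ≤ ‖γ - β‖ * P.supNorm ^ w := by
    refine hw _ (not_le.mp hH).le β fun n hn => ?_
    obtain ⟨hn1, hn2, hn3⟩ := hn₀ n hn
    refine (hM n hn2 hn3 P β hPd.le hP.2 hβ fun h0 => ?_).trans ?_
    -- `P` cannot be the minimal polynomial of both `β` and the partial sum.
    · have := IsIntMinpoly.natDegree_eq ⟨hP.1, h0⟩
      omega
    · have hML : M ^ s n ≤ q ^ (L * s n) := by
        rw [pow_mul]
        exact pow_le_pow_left₀ (by linarith) hL.le _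
      gcongr
  have h2 : P.supNorm ^ (-((w : ℝ) + 1)) * P.supNorm ^ w ≤ 1 := by
    rw [← Real.rpow_natCast, ← Real.rpow_add (by linarith)]
    exact Real.rpow_le_one_of_one_le_of_nonpos hH1 (by linarith)
  have h3 := mul_lt_mul_of_pos_right hlt (show 0 < P.supNorm ^ w by positivity)
  linarith

end PowerSeries.IsGeneralizedLiouvilleWith

theorem mainTheorem2 (f : PowerSeries ℤ) (s t : ℕ → ℕ)
    (hf : f.IsGeneralizedLiouvilleWith s t)
    (m : ℕ) (α : ℂ) (hint : IsIntegral ℤ α) (hsimple : IsSimpleAlgebraic α)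
    (hdeg : (minpoly ℚ α).natDegree = m)
    (hα : ENNReal.ofReal ‖α‖ < f.complexRadius)
    (hMahler : {n : ℕ | 1 ≤ n ∧ Polynomial.aeval α (f.lacunaryBlock s t n) ≠ 0}.Infinite) :
    IsUmNumber m (f.complexValue α) := by
  have htr := hf.transcendental_complexValue hint hα hMahler
  have hdegn := hf.eventually_natDegree_minpoly_eq hint hsimple hα htr
  rw [hdeg] at hdegn
  have hm : 0 < m := hdeg ▸ minpoly.natDegree_pos hint.tower_top
  refine ⟨htr, ⟨hm, fun w _ => hf.infinite_closeAlgebraicNumbers hint hα htr hdegn w⟩, ?_⟩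
  rintro d ⟨-, hd⟩
  by_contra hlt
  obtain ⟨w, hw, hfin⟩ := hf.exists_finite_closeAlgebraicNumbers hint hα hdegn (not_le.mp hlt)
  exact hd w hw hfin
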